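/- Consider a network with a finite set $V$ of nodes and a finite set $\mathcal E$ of directed links, operating in discrete time slots $t=1,2,\dots$, with no limit on instantaneous bandwidth and no interference between links. There are finitely many flows; flow $f$ has source $s_f$, destination $d_f\ne s_f$ and weight $\beta_f\ge 0$. In each slot at most $B$ packets of each flow arrive at its source; the vectors of arrival numbers are i.i.d. over time. An attempt to transmit a packet on a link $\ell$ takes one slot, uses one unit of bandwidth and succeeds with probability $p_\ell$; outcomes are independent across slots and links, and independent of the arrivals (the dependence between different packets on the same link in the same slot is arbitrary). A packet has age $0$ in the slot of its arrival, may be transmitted on at most one link out of its current node in each slot in which its age is less than the deadline $\tau\ge 1$, and leaves the network when it is delivered to $d_f$ or when its age reaches $\tau$. The network is empty before the first slot. A policy $\pi$ chooses in each slot, possibly at random and depending on the whole history, for each packet present the link on which it is transmitted, if any. As usual only those policies are admitted for which the long-run averages exist, namely the timely throughput $\bar D_f=\lim_{T\to\infty}\frac1T\mathbb E\sum_{t\le T}D_f(t)$, where $D_f(t)$ is the number of packets of flow $f$ delivered in slot $t$, and the average bandwidth $\bar C^\pi_\ell$, the analogous average of the number of packets transmitted on $\ell$. For link prices $\mu_\ell\ge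 0$ and constants $C^{av}_\ell$ let $$\mathcal L(\pi,\mu)=\sum_f\beta_f\bar D_f-\sum_\ell\mu_\ell\,(\bar C^\pi_\ell-C^{av}_\ell),\qquad D(\mu)=\sup_\pi\mathcal L(\pi,\mu).$$ Single Packet Optimal Transportation Problem for flow $f$: one packet starts at $s_f$ with age $0$. A packet policy selects, as a function of its location $i$ and age $s<\tau$, either no transmission or a link $\ell=(i,j)$; a transmission costs $\mu_\ell$ and moves the packet to $j$ with probability $p_\ell$. Reaching $d_f$ by age $\tau$ earns $\beta_f$ and ends the process. Maximize the expected net reward. The dynamic programming equations are $$V_f(i,s)=\max\Big\{V_f(i,s+1),\ \max_{\ell=(i,j)}\big(-\mu_\ell+p_\ell V_f(j,s+1)+(1-p_\ell)V_f(i,s+1)\big)\Big\}\qquad(i\ne d_f,\ s<\tau),$$ with $V_f(d_f,s)=\beta_f$ for $s\le\tau$ and $V_f(i,\tau)=0$ for $i\neq d_f$; a decision at $(i,s)$ is called optimal if it attains the maximum. Write $\otimes_f\pi_f$ for the network policy that applies the packet policy $\pi_f$ to each packet of flow $f$ independently of all other packets. Then, for every fixed $\mu\ge0$: (i) For every flow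 $f$ there are packet policies all of whose decisions at $(i,s)$, $i\ne d_f$, $s<\tau$, are optimal, and each of them solves the single packet problem. (ii) If $\pi^\star_f(\mu)$ solves the single packet problem of flow $f$ for every $f$, then $\pi^\star(\mu)=\otimes_f\pi^\star_f(\mu)$ is admitted and maximizes the Lagrangian: $\mathcal L(\pi^\star(\mu),\mu)=\max_\pi\mathcal L(\pi,\mu)=D(\mu)$. (iii) A product policy $\otimes_f\pi_f$ is admitted and maximizes $\mathcal L(\cdot,\mu)$ if and only if $\pi_f$ solves the single packet problem for every flow $f$ that has arrivals with positive probability. (iv) For an arbitrary admitted policy $\pi$ the following are equivalent: $\pi$ maximizes $\mathcal L(\cdot,\mu)$; $\mathcal L(\pi,\mu)=D(\mu)$; $\pi$ implements the single packet solution for all packets up to a zero long-run frequency, that is, $\lim_{T\to\infty}\frac1T\mathbb E\sum_{t\le T}N(t)=0$, where $N(t)$ is the number of packets in the network in slot $t$ for which the decision taken by $\pi$ is not optimal. -/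

import Mathlib

open Filter Topology
open scoped NNReal ENNReal

noncomputable section

namespace TimelyThroughput

/-- The law of a coin that shows `true` with probability `p`. -/
def coin (p : ℝ≥0) (hp : p ≤ 1) : PMF Bool :=
  PMF.ofFintype (fun b => cond b (p : ℝ≥0∞) (1 - (p : ℝ≥0∞))) (by simp [hp])

/-- The joint law of finitely many independent random variables with given laws. -/
def independent {ι α : Type*} [Fintype ι] [DecidableEq ι] [Fintype α]
    (q : ι → PMF α) : PMF (ι → α) :=
  PMF.ofFintype (fun w => ∏ i, q i (w i)) (by
    have h : ∀ i, ∑ a, q i a = 1 := fun i => by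
      rw [← tsum_fintype (L := .unconditional α)]; exact (q i).tsum_coe
    rw [← Fintype.piFinset_univ, ← Finset.prod_univ_sum]
    simp [h])

/-- The expectation of a real function on a finite probability space. -/
def expect {α : Type*} [Fintype α] (q : PMF α) (φ : α → ℝ) : ℝ :=
  ∑ a, (q a).toReal * φ a

/-- The price of a decision: `μ ℓ` for a transmission on `ℓ`, nothing for no transmission. -/
def price {E : Type*} (μ : E → ℝ) : Option E → ℝ
  | none => 0
  | some ℓ => μ ℓ

/-- The Cesàro mean of the first `T` terms of a sequence. -/
def timeAverage (a : ℕ → ℝ) (T : ℕ) : ℝ :=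
  (∑ t ∈ Finset.range T, a t) / T

/-- A multihop network with unreliable links and deadline-constrained flows.  `V` is the set of
nodes, `E` the set of directed links, `F` the set of flows.

A packet that is present in the network occupies a slot `(f, s, k)`: it belongs to flow `f`, its
age is `s < τ`, and it has the number `k` among the packets of its flow and its age.

In each time slot the vector of the numbers of arriving packets has law `arrival`, so that
every flow receives at most `B` packets; the vectors are independent over time.  For each link `ℓ`
and each time slot, `channel ℓ` is the joint law of the indicators that say whether a transmission
of the packet in a given slot over `ℓ` succeeds.  Every such transmission succeeds with
probability `p ℓ`; different links, and different times, are independent.  How the outcomes for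
different packets on the same link in the same time slot depend on each other is left free. -/
structure Network (V E F : Type*) where
  src : E → V
  dst : E → V
  p : E → ℝ≥0
  p_le_one : ∀ ℓ, p ℓ ≤ 1
  source : F → V
  dest : F → V
  source_ne_dest : ∀ f, source f ≠ dest f
  β : F → ℝ
  β_nonneg : ∀ f, 0 ≤ β f
  τ : ℕ
  one_le_τ : 1 ≤ τ
  B : ℕ
  arrival : PMF (F → Fin (B + 1))
  channel : E → PMF (F × Fin τ × Fin B → Bool)
  channel_marginal : ∀ ℓ σ, (channel ℓ).map (fun w => w σ) = coin (p ℓ) (p_le_one ℓ)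

namespace Network

variable {V E F : Type*} [Fintype V] [DecidableEq V] [Fintype E] [DecidableEq E]
  [Fintype F] [DecidableEq F] (N : Network V E F)

/-! ### The network with many packets -/

/-- The slots `(flow, age, number)` that packets can occupy. -/
abbrev Slot : Type _ := F × Fin N.τ × Fin N.B

/-- The state of the network: the node at which the packet of each slot is, and `none` if there is
no such packet (never arrived, or already delivered). -/
abbrev State : Type _ := N.Slot → Option V

/-- An action: the link on which each packet is transmitted, `none` if it is not transmitted. -/
abbrev Action : Type _ := N.Slot → Option E

/-- What happens in one time slot: the state, the action, and, for each packet, whether it was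
transmitted successfully. -/
abbrev Record : Type _ := N.State × N.Action × (N.Slot → Bool)

/-- An action is feasible if each transmitted packet is present at the tail of its link. There
is no further constraint: bandwidth is unlimited and links do not interfere. -/
def Feasible (x : N.State) (u : N.Action) : Prop :=
  ∀ σ ℓ, u σ = some ℓ → x σ = some (N.src ℓ)

/-- A history-dependent, possibly randomized scheduling policy: the law of the action, given the
records of the past time slots (latest first) and the present state. -/
structure Policy where
  act : List N.Record → N.State → PMF N.Action
  feasible : ∀ h x, ∀ u ∈ (act h x).support, N.Feasible x u

/-- The packets that are transmitted successfully, given the outcomes `w` of the links. -/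
def success (u : N.Action) (w : E → N.Slot → Bool) (σ : N.Slot) : Bool :=
  match u σ with
  | none => false
  | some ℓ => w ℓ σ

/-- The packet `σ` reaches its destination in the time slot with record `z`. -/
def Delivered (z : N.Record) (σ : N.Slot) : Prop :=
  ∃ ℓ, z.2.1 σ = some ℓ ∧ N.dst ℓ = N.dest σ.1 ∧ z.2.2 σ = true

/-- The location of the packet `σ` after the time slot with record `z`; `none` if it is absent. -/
def advance (z : N.Record) (σ : N.Slot) : Option V :=
  match z.1 σ, z.2.1 σ with
  | none, _ => none
  | some i, none => some i
  | some i, some ℓ =>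
      if z.2.2 σ then (if N.dst ℓ = N.dest σ.1 then none else some (N.dst ℓ)) else some i

/-- The next state: packets of positive age are the survivors of the preceding time slot, packets
of age zero are the `a f` new arrivals of flow `f` at its source.  Packets whose age reaches `τ`
leave the network. -/
def next (z : N.Record) (a : F → Fin (N.B + 1)) : N.State :=
  fun σ =>
    if h : σ.2.1.val = 0 then
      (if σ.2.2.val < (a σ.1).val then some (N.source σ.1) else none)
    else
      N.advance z (σ.1, ⟨σ.2.1.val - 1, by omega⟩, σ.2.2)

/-- The first state: the network is empty except for the first arrivals. -/
def firstState (a : F → Fin (N.B + 1)) : N.State :=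
  fun σ => if σ.2.1.val = 0 ∧ σ.2.2.val < (a σ.1).val then some (N.source σ.1) else none

/-- The law of the record of a time slot that starts in state `x` after the past `h`. -/
def recordLaw (π : N.Policy) (h : List N.Record) (x : N.State) : PMF N.Record :=
  (π.act h x).bind fun u => (independent N.channel).map fun w => (x, u, N.success u w)

/-- The joint law, under a policy, of the records of the first `t` time slots and of the state at
the start of the time slot after them. -/
def historyLaw (π : N.Policy) : ℕ → PMF (List N.Record × N.State)
  | 0 => N.arrival.map fun a => ([], N.firstState a)
  | t + 1 => (historyLaw π t).bind fun hx =>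
      (N.recordLaw π hx.1 hx.2).bind fun z => N.arrival.map fun a => (z :: hx.1, N.next z a)

/-- The law under a policy of the record of the time slot with index `t` (the first is `0`). -/
def slotLaw (π : N.Policy) (t : ℕ) : PMF N.Record :=
  (N.historyLaw π t).bind fun hx => N.recordLaw π hx.1 hx.2

open scoped Classical in
/-- The number of packets of flow `f` that reach their destination. All of them are in time, since
packets leave the network when their age reaches `τ`. -/
def deliveries (f : F) (z : N.Record) : ℝ :=
  ((Finset.univ.filter fun σ : N.Slot => σ.1 = f ∧ N.Delivered z σ).card : ℝ)

/-- The number of packets that are transmitted on the link `ℓ`. -/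
def linkUse (ℓ : E) (z : N.Record) : ℝ :=
  ((Finset.univ.filter fun σ : N.Slot => z.2.1 σ = some ℓ).card : ℝ)

/-- The expected averages over the first `T` time slots of the number of deliveries of `f`. -/
def averageDeliveries (π : N.Policy) (f : F) : ℕ → ℝ :=
  timeAverage fun t => expect (N.slotLaw π t) (N.deliveries f)

/-- The expected averages over the first `T` time slots of the bandwidth used on `ℓ`. -/
def averageLinkUse (π : N.Policy) (ℓ : E) : ℕ → ℝ :=
  timeAverage fun t => expect (N.slotLaw π t) (N.linkUse ℓ)

/-- The long-run averages of all deliveries and of the bandwidths used on all links exist. -/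
def Convergent (π : N.Policy) : Prop :=
  (∀ f, ∃ D, Tendsto (N.averageDeliveries π f) atTop (𝓝 D)) ∧
    ∀ ℓ, ∃ C, Tendsto (N.averageLinkUse π ℓ) atTop (𝓝 C)

/-- The timely throughput of flow `f` (meaningful for convergent policies). -/
def timelyThroughput (π : N.Policy) (f : F) : ℝ :=
  limUnder atTop (N.averageDeliveries π f)

/-- The average bandwidth used on the link `ℓ` (meaningful for convergent policies). -/
def averageBandwidth (π : N.Policy) (ℓ : E) : ℝ :=
  limUnder atTop (N.averageLinkUse π ℓ)

/-- The Lagrangian of the problem of maximizing the weighted timely throughput when the average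
bandwidth of each link `ℓ` is at most `Cav ℓ`. -/
def lagrangian (Cav : E → ℝ) (π : N.Policy) (μ : E → ℝ) : ℝ :=
  ∑ f, N.β f * N.timelyThroughput π f - ∑ ℓ, μ ℓ * (N.averageBandwidth π ℓ - Cav ℓ)

/-- The dual function. -/
def dual (Cav : E → ℝ) (μ : E → ℝ) : ℝ :=
  sSup {L | ∃ π : N.Policy, N.Convergent π ∧ L = N.lagrangian Cav π μ}

/-- The policy `π` maximizes the Lagrangian for the link prices `μ`. -/
def MaximizesLagrangian (Cav : E → ℝ) (μ : E → ℝ) (π : N.Policy) : Prop :=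
  N.Convergent π ∧
    ∀ π' : N.Policy, N.Convergent π' → N.lagrangian Cav π' μ ≤ N.lagrangian Cav π μ

/-! ### The transportation problem of a single packet -/

/-- A policy for a single packet: the link on which it is transmitted, or `none`, as a function of
its location and its age. -/
structure PacketPolicy where
  act : V → ℕ → Option E
  feasible : ∀ i s ℓ, act i s = some ℓ → N.src ℓ = i

/-- The law of the location of a packet at `i` after one decision. -/
def move (i : V) : Option E → PMF V
  | none => PMF.pure i
  | some ℓ => (coin (N.p ℓ) (N.p_le_one ℓ)).map fun b => if b then N.dst ℓ else i

/-- The law of the location at age `s` of a single packet of flow `f` that is generated at its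
source at age `0` and stays at its destination once it is there. -/
def packetLaw (f : F) (g : N.PacketPolicy) : ℕ → PMF V
  | 0 => PMF.pure (N.source f)
  | s + 1 => (packetLaw f g s).bind fun i =>
      if i = N.dest f then PMF.pure i else N.move i (g.act i s)

/-- The expected net reward of a single packet: `β f` if it is at its destination when its age
is `τ`, less the prices of the links on which it was transmitted before. -/
def netReward (μ : E → ℝ) (f : F) (g : N.PacketPolicy) : ℝ :=
  N.β f * (N.packetLaw f g N.τ (N.dest f)).toReal -
    ∑ s ∈ Finset.range N.τ,
      expect (N.packetLaw f g s) fun i =>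
        if i = N.dest f then 0 else price μ (g.act i s)

/-- `g` solves the single packet optimal transportation problem of flow `f`. -/
def SolvesTransportation (μ : E → ℝ) (f : F) (g : N.PacketPolicy) : Prop :=
  ∀ g' : N.PacketPolicy, N.netReward μ f g' ≤ N.netReward μ f g

/-- The decisions that are available to a packet at the node `i`. -/
def available (i : V) : Finset (Option E) :=
  Finset.univ.filter fun u => ∀ ℓ, u = some ℓ → N.src ℓ = i

/-- The value of a decision for a packet at `i`, if `W j` is the value of being at `j` in the next
time slot. -/
def decisionValue (μ : E → ℝ) (W : V → ℝ) (i : V) (u : Option E) : ℝ :=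
  -price μ u + expect (N.move i u) W

/-- The optimal net reward that a packet of flow `f` can still earn, by the number of time slots
that remain until its deadline. -/
def valueToGo (μ : E → ℝ) (f : F) : ℕ → V → ℝ
  | 0 => fun i => if i = N.dest f then N.β f else 0
  | n + 1 => fun i =>
      if i = N.dest f then N.β f
      else (N.available i).sup' ⟨none, by simp [available]⟩
        (N.decisionValue μ (valueToGo μ f n) i)

/-- The solution of the dynamic programming equations, as a function of location and age. -/
def value (μ : E → ℝ) (f : F) (i : V) (s : ℕ) : ℝ :=
  N.valueToGo μ f (N.τ - s) i

/-- The decision `u` attains the maximum in the dynamic programming equation at location `i` and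
age `s`. -/
def OptimalDecision (μ : E → ℝ) (f : F) (i : V) (s : ℕ) (u : Option E) : Prop :=
  u ∈ N.available i ∧
    ∀ u' ∈ N.available i,
      N.decisionValue μ (fun j => N.value μ f j (s + 1)) i u' ≤
        N.decisionValue μ (fun j => N.value μ f j (s + 1)) i u

/-- All decisions of `g` for undelivered packets of age less than `τ` attain the maximum in the
dynamic programming equations. -/
def SolvesDP (μ : E → ℝ) (f : F) (g : N.PacketPolicy) : Prop :=
  ∀ i, i ≠ N.dest f → ∀ s < N.τ, N.OptimalDecision μ f i s (g.act i s)

/-! ### From single packets to the network -/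

/-- The policy `⊗_f g f`: every packet of flow `f` is treated according to `g f`, on the basis of
its own location and age only. -/
def product (g : F → N.PacketPolicy) : N.Policy where
  act _ x := PMF.pure fun σ => (x σ).bind fun i => (g σ.1).act i σ.2.1
  feasible := by
    intro h x u hu σ ℓ hℓ
    rw [PMF.support_pure, Set.mem_singleton_iff] at hu
    subst hu
    obtain ⟨i, hi, hg⟩ := Option.bind_eq_some_iff.mp hℓ
    rw [hi, (g σ.1).feasible i _ ℓ hg]

open scoped Classical in
/-- The number of packets in the network for which the decision taken is not optimal in the
transportation problem of the single packet. -/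
def suboptimalDecisions (μ : E → ℝ) (z : N.Record) : ℝ :=
  ((Finset.univ.filter fun σ : N.Slot =>
    ∃ i, z.1 σ = some i ∧ ¬ N.OptimalDecision μ σ.1 i σ.2.1 (z.2.1 σ)).card : ℝ)

/-- The long-run average of the expected number of packets that are treated suboptimally is
zero. -/
def TreatsPacketsOptimally (μ : E → ℝ) (π : N.Policy) : Prop :=
  Tendsto (timeAverage fun t => expect (N.slotLaw π t) (N.suboptimalDecisions μ)) atTop (𝓝 0)

/-- With positive probability a packet of flow `f` arrives in a time slot. -/
def HasTraffic (f : F) : Prop :=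
  ∃ a ∈ N.arrival.support, 0 < (a f).val

end Network

end TimelyThroughput

end

/-! Dynamic programming values serve as a potential. Let `gap` be the loss of a decision: the value
of the current location and age minus the value of the decision. It is nonnegative for an available
decision of an undelivered packet before its deadline, and zero exactly when the decision is
optimal. For a single packet, telescoping the values along its path gives `netReward_eq`: the net
reward is the value at the source minus the expected gaps. This settles the single packet problem.

In the network, give each state the sum of the values of the packets present. There is no coupling
constraint and rewards and prices add over packets, so the one-packet balance
`expect_packetReward_add` sums to the drift identity `expect_slotReward`: for every policy, expected
slot reward = arrival value + decrease of the potential - expected total gap. The state space is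
finite, so the potential is bounded and its decrease vanishes in the long-run average. Hence the
Lagrangian of a convergent policy is a constant `optimum`, the same for all policies, minus the
long-run average gap (`Convergent.tendsto_timeAverage_totalGap`). Only finitely many gaps occur, so
the average gap vanishes iff the frequency of suboptimal decisions does (`exists_totalGap_bounds`).

Under a product policy each packet follows its own single packet law, so from slot `τ` on the
expected gap is constant. It equals the sum over flows of arrival rate times shortfall of the net
reward (`expect_totalGap_product`). Hence product policies converge, they attain `optimum` exactly
when every flow with traffic is solved optimally, and the dual function equals `optimum`. -/

noncomputable section

set_option linter.unusedSectionVars false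

namespace TimelyThroughput

/-! ### Expectations on finite spaces and marginals of independent variables -/

section Expect

variable {α γ ι : Type*}

/-- The mixing law may live on an infinite type, as needed for histories, so only the target is
assumed finite. -/
theorem expect_bind_tsum [Fintype γ] (q : PMF α) (k : α → PMF γ) (φ : γ → ℝ) :
    expect (q.bind k) φ = ∑' a, (q a).toReal * expect (k a) φ := by
  have hne : ∀ b a, q a * k a b ≠ ⊤ := fun b a =>
    ENNReal.mul_ne_top (PMF.apply_ne_top _ _) (PMF.apply_ne_top _ _)
  have hs : ∀ b, Summable fun a => (q a * k a b).toReal := fun b => by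
    apply ENNReal.summable_toReal
    rw [← PMF.bind_apply]
    exact PMF.apply_ne_top _ _
  simp only [expect, Finset.mul_sum]
  rw [Summable.tsum_finsetSum]
  · refine Finset.sum_congr rfl fun b _ => ?_
    rw [PMF.bind_apply, ENNReal.tsum_toReal_eq (hne b), ← tsum_mul_right]
    simp only [ENNReal.toReal_mul, mul_assoc]
  · intro b _
    have := (hs b).mul_right (φ b)
    simpa only [ENNReal.toReal_mul, mul_assoc] using this

theorem expect_bind [Fintype α] [Fintype γ] (q : PMF α) (k : α → PMF γ) (φ : γ → ℝ) :
    expect (q.bind k) φ = expect q fun a => expect (k a) φ := by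
  rw [expect_bind_tsum, tsum_fintype]
  rfl

theorem expect_pure [Fintype α] (a : α) (φ : α → ℝ) : expect (PMF.pure a) φ = φ a := by
  classical
  rw [expect, Finset.sum_eq_single a]
  · simp
  · intro b _ hb
    simp [PMF.pure_apply, hb]
  · simp

theorem expect_map [Fintype α] [Fintype γ] (q : PMF α) (g : α → γ) (φ : γ → ℝ) :
    expect (q.map g) φ = expect q fun a => φ (g a) := by
  rw [← PMF.bind_pure_comp, expect_bind]
  simp only [Function.comp_apply, expect_pure]

variable [Fintype α] (q : PMF α)

theorem expect_add (φ ψ : α → ℝ) :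
    expect q (fun a => φ a + ψ a) = expect q φ + expect q ψ := by
  simp only [expect, mul_add, Finset.sum_add_distrib]

theorem expect_sub (φ ψ : α → ℝ) :
    expect q (fun a => φ a - ψ a) = expect q φ - expect q ψ := by
  simp only [expect, mul_sub, Finset.sum_sub_distrib]

theorem expect_const_mul (c : ℝ) (φ : α → ℝ) :
    expect q (fun a => c * φ a) = c * expect q φ := by
  simp only [expect, Finset.mul_sum, mul_left_comm]

theorem expect_sum (s : Finset ι) (φ : ι → α → ℝ) :
    expect q (fun a => ∑ i ∈ s, φ i a) = ∑ i ∈ s, expect q (φ i) := by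
  simp only [expect, Finset.mul_sum]
  exact Finset.sum_comm

theorem sum_toReal_eq_one : ∑ a, (q a).toReal = 1 := by
  rw [← ENNReal.toReal_sum fun a _ => PMF.apply_ne_top q a, ← tsum_fintype (L := .unconditional α),
    PMF.tsum_coe, ENNReal.toReal_one]

theorem expect_const (c : ℝ) : expect q (fun _ => c) = c := by
  rw [expect, ← Finset.sum_mul, sum_toReal_eq_one, one_mul]

variable {q}

theorem expect_congr {φ ψ : α → ℝ} (h : ∀ a ∈ q.support, φ a = ψ a) :
    expect q φ = expect q ψ := by
  refine Finset.sum_congr rfl fun a _ => ?_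
  by_cases ha : a ∈ q.support
  · rw [h a ha]
  · rw [PMF.mem_support_iff, not_not] at ha
    simp [ha]

theorem expect_mono {φ ψ : α → ℝ} (h : ∀ a ∈ q.support, φ a ≤ ψ a) :
    expect q φ ≤ expect q ψ := by
  refine Finset.sum_le_sum fun a _ => ?_
  by_cases ha : a ∈ q.support
  · exact mul_le_mul_of_nonneg_left (h a ha) ENNReal.toReal_nonneg
  · rw [PMF.mem_support_iff, not_not] at ha
    simp [ha]

theorem expect_nonneg {φ : α → ℝ} (h : ∀ a ∈ q.support, 0 ≤ φ a) : 0 ≤ expect q φ := by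
  rw [← expect_const q 0]
  exact expect_mono h

theorem expect_pos {φ : α → ℝ} (h : ∀ a ∈ q.support, 0 ≤ φ a) {b : α} (hb : b ∈ q.support)
    (hφ : 0 < φ b) : 0 < expect q φ := by
  refine Finset.sum_pos' (fun a _ => ?_) ⟨b, Finset.mem_univ b, ?_⟩
  · by_cases ha : a ∈ q.support
    · exact mul_nonneg ENNReal.toReal_nonneg (h a ha)
    · rw [PMF.mem_support_iff, not_not] at ha
      simp [ha]
  · exact mul_pos (ENNReal.toReal_pos hb (PMF.apply_ne_top q b)) hφ

theorem expect_bind_congr {δ : Type*} {r : PMF δ} {k : δ → PMF α} {φ ψ : α → ℝ}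
    (h : ∀ d ∈ r.support, expect (k d) φ = expect (k d) ψ) :
    expect (r.bind k) φ = expect (r.bind k) ψ := by
  rw [expect_bind_tsum, expect_bind_tsum]
  refine tsum_congr fun d => ?_
  by_cases hd : d ∈ r.support
  · rw [h d hd]
  · rw [PMF.mem_support_iff, not_not] at hd
    simp [hd]

theorem expect_coin (p : ℝ≥0) (hp : p ≤ 1) (φ : Bool → ℝ) :
    expect (coin p hp) φ = p * φ true + (1 - p) * φ false := by
  have h : ((1 : ℝ≥0∞) - (p : ℝ≥0∞)).toReal = 1 - (p : ℝ) := by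
    rw [ENNReal.toReal_sub_of_le (by exact_mod_cast hp) ENNReal.one_ne_top]
    simp
  simp [expect, coin, h]

/-- Written as a factor at coordinate `i`, the indicator of the event lets the sum over all
functions split into a product of sums. Every factor other than the one at `i` is a total mass 1. -/
theorem independent_map_apply [Fintype ι] [DecidableEq ι] (r : ι → PMF α) (i : ι) :
    (independent r).map (fun w => w i) = r i := by
  classical
  ext b
  have h1 : ∀ j, ∑ a, r j a = 1 := fun j => by
    rw [← tsum_fintype (L := .unconditional α)]; exact (r j).tsum_coe
  have h2 : ∀ w : ι → α, (if b = w i then ∏ j, r j (w j) else 0)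
      = ∏ j, (r j (w j) * if j = i then (if b = w j then 1 else 0) else 1) := fun w => by
    rw [Finset.prod_mul_distrib, Finset.prod_ite_eq' Finset.univ i]
    simp
  rw [PMF.map_apply, tsum_fintype]
  simp only [independent, PMF.ofFintype_apply]
  rw [Finset.sum_congr rfl fun w _ => h2 w, ← Fintype.piFinset_univ,
    ← Finset.prod_univ_sum (fun _ => Finset.univ)
      fun j a => r j a * if j = i then (if b = a then 1 else 0) else 1,
    Finset.prod_eq_single i]
  · simp
  · intro j _ hj
    simp [hj, h1]
  · simp

end Expect

/-! ### Cesàro means -/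

section Average

theorem timeAverage_add (a b : ℕ → ℝ) (T : ℕ) :
    timeAverage (fun t => a t + b t) T = timeAverage a T + timeAverage b T := by
  simp only [timeAverage, Finset.sum_add_distrib, add_div]

theorem timeAverage_sub (a b : ℕ → ℝ) (T : ℕ) :
    timeAverage (fun t => a t - b t) T = timeAverage a T - timeAverage b T := by
  simp only [timeAverage, Finset.sum_sub_distrib, sub_div]

theorem timeAverage_const_mul (c : ℝ) (a : ℕ → ℝ) (T : ℕ) :
    timeAverage (fun t => c * a t) T = c * timeAverage a T := by
  simp only [timeAverage, ← Finset.mul_sum, mul_div_assoc]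

theorem timeAverage_sum {ι : Type*} (s : Finset ι) (a : ι → ℕ → ℝ) (T : ℕ) :
    timeAverage (fun t => ∑ i ∈ s, a i t) T = ∑ i ∈ s, timeAverage (a i) T := by
  simp only [timeAverage, ← Finset.sum_div]
  rw [Finset.sum_comm]

theorem timeAverage_mono {a b : ℕ → ℝ} (h : ∀ t, a t ≤ b t) (T : ℕ) :
    timeAverage a T ≤ timeAverage b T :=
  div_le_div_of_nonneg_right (Finset.sum_le_sum fun t _ => h t) (Nat.cast_nonneg T)

theorem tendsto_timeAverage {a : ℕ → ℝ} {l : ℝ} (h : Tendsto a atTop (𝓝 l)) :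
    Tendsto (timeAverage a) atTop (𝓝 l) := by
  refine h.cesaro.congr fun T => ?_
  rw [timeAverage, div_eq_inv_mul]

theorem tendsto_timeAverage_of_eventually_eq {a : ℕ → ℝ} {l : ℝ} {n : ℕ} (h : ∀ t ≥ n, a t = l) :
    Tendsto (timeAverage a) atTop (𝓝 l) :=
  tendsto_timeAverage (tendsto_const_nhds.congr' (by
    filter_upwards [eventually_ge_atTop n] with t ht using (h t ht).symm))

theorem tendsto_timeAverage_telescope {a : ℕ → ℝ} {C : ℝ} (h : ∀ t, |a t| ≤ C) :
    Tendsto (timeAverage fun t => a t - a (t + 1)) atTop (𝓝 0) := by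
  have h0 : Tendsto (fun T : ℕ => (2 * C) / (T : ℝ)) atTop (𝓝 0) :=
    tendsto_const_div_atTop_nhds_zero_nat _
  refine squeeze_zero_norm (fun T => ?_) h0
  rw [timeAverage, Finset.sum_range_sub', norm_div, Real.norm_eq_abs, Real.norm_natCast]
  refine div_le_div_of_nonneg_right ?_ (Nat.cast_nonneg T)
  calc |a 0 - a T| ≤ |a 0| + |a T| := abs_sub _ _
    _ ≤ 2 * C := by linarith [h 0, h T]

end Average

/-! ### Uniform bounds on finite index sets -/

section Finite

variable {ι : Type*} [Fintype ι]

theorem exists_pos_le_of_pos (g : ι → ℝ) : ∃ c > 0, ∀ i, 0 < g i → c ≤ g i := by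
  -- The witness is the reciprocal of this sum. Every positive `g i` has its inverse among the
  -- summands, and the 1 covers an empty index set or a vanishing `g`.
  have hs : 0 < 1 + ∑ i, |g i|⁻¹ :=
    add_pos_of_pos_of_nonneg one_pos (Finset.sum_nonneg fun i _ => inv_nonneg.2 (abs_nonneg _))
  refine ⟨(1 + ∑ i, |g i|⁻¹)⁻¹, inv_pos.2 hs, fun i hi => inv_le_of_inv_le₀ hi ?_⟩
  have := Finset.single_le_sum (f := fun i => |g i|⁻¹)
    (fun i _ => inv_nonneg.2 (abs_nonneg (g i))) (Finset.mem_univ i)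
  simp only [abs_of_pos hi] at this
  linarith

theorem exists_forall_abs_le (g : ι → ℝ) : ∃ C, ∀ i, |g i| ≤ C :=
  ⟨∑ i, |g i|, fun i => Finset.single_le_sum (f := fun i => |g i|)
    (fun i _ => abs_nonneg (g i)) (Finset.mem_univ i)⟩

end Finite

namespace Network

variable {V E F : Type*} [Fintype V] [DecidableEq V] [Fintype E] [DecidableEq E]
  [Fintype F] [DecidableEq F] (N : Network V E F)

section

variable (μ : E → ℝ) (f : F)

/-! ### The single packet problem -/

theorem mem_available {i : V} {u : Option E} :
    u ∈ N.available i ↔ ∀ ℓ, u = some ℓ → N.src ℓ = i := by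
  simp [available]

theorem act_mem_available (g : N.PacketPolicy) (i : V) (s : ℕ) : g.act i s ∈ N.available i :=
  N.mem_available.2 (g.feasible i s)

theorem value_dest (s : ℕ) : N.value μ f (N.dest f) s = N.β f := by
  rw [value]
  cases N.τ - s <;> simp [valueToGo]

theorem value_deadline {i : V} (hi : i ≠ N.dest f) : N.value μ f i N.τ = 0 := by
  simp [value, valueToGo, hi]

/-- The loss from the decision `u` for a packet of age `s` at `i` that is treated optimally
afterwards. -/
def gap (i : V) (s : ℕ) (u : Option E) : ℝ :=
  N.value μ f i s - N.decisionValue μ (fun j => N.value μ f j (s + 1)) i u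

variable {N f} in
theorem value_eq_sup' {i : V} (hi : i ≠ N.dest f) {s : ℕ} (hs : s < N.τ) :
    N.value μ f i s = (N.available i).sup' ⟨none, by simp [available]⟩
      (N.decisionValue μ (fun j => N.value μ f j (s + 1)) i) := by
  have h : N.τ - s = (N.τ - (s + 1)) + 1 := by omega
  rw [value, h]
  exact if_neg hi

variable {N f} in
theorem gap_nonneg {i : V} (hi : i ≠ N.dest f) {s : ℕ} (hs : s < N.τ) {u : Option E}
    (hu : u ∈ N.available i) : 0 ≤ N.gap μ f i s u := by
  rw [gap, value_eq_sup' μ hi hs]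
  exact sub_nonneg.2 (Finset.le_sup' _ hu)

variable {N f} in
theorem gap_eq_zero_iff {i : V} (hi : i ≠ N.dest f) {s : ℕ} (hs : s < N.τ) {u : Option E}
    (hu : u ∈ N.available i) : N.gap μ f i s u = 0 ↔ N.OptimalDecision μ f i s u := by
  rw [gap, value_eq_sup' μ hi hs, sub_eq_zero]
  constructor
  · intro h
    exact ⟨hu, fun u' hu' => h ▸ Finset.le_sup' _ hu'⟩
  · intro h
    exact le_antisymm (Finset.sup'_le _ _ h.2) (Finset.le_sup' _ hu)

theorem exists_optimalDecision (i : V) (s : ℕ) : ∃ u, N.OptimalDecision μ f i s u := by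
  obtain ⟨u, hu, h⟩ := Finset.exists_max_image (N.available i)
    (N.decisionValue μ (fun j => N.value μ f j (s + 1)) i) ⟨none, by simp [available]⟩
  exact ⟨u, hu, h⟩

theorem exists_solvesDP : ∃ g, N.SolvesDP μ f g := by
  choose u hu using N.exists_optimalDecision μ f
  exact ⟨⟨u, fun i s => N.mem_available.1 (hu i s).1⟩, fun i _ s _ => hu i s⟩

/-- The expected loss of a packet policy at age `s`. -/
def expectedGap (g : N.PacketPolicy) (s : ℕ) : ℝ :=
  expect (N.packetLaw f g s) fun i => if i = N.dest f then 0 else N.gap μ f i s (g.act i s)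

/-- The definition of `gap` rearranged: a decision leaves, on average, the current value minus the
gap plus the price paid. At the destination the value is constantly `β f`, and nothing is lost or
paid. -/
theorem expect_value_succ (g : N.PacketPolicy) (s : ℕ) :
    expect (N.packetLaw f g (s + 1)) (fun i => N.value μ f i (s + 1)) =
      expect (N.packetLaw f g s) (fun i => N.value μ f i s) - N.expectedGap μ f g s +
        expect (N.packetLaw f g s)
          (fun i => if i = N.dest f then 0 else price μ (g.act i s)) := by
  rw [expectedGap, ← expect_sub, ← expect_add, packetLaw, expect_bind]
  refine expect_congr fun i _ => ?_
  by_cases hi : i = N.dest f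
  · subst hi
    simp [expect_pure, value_dest]
  · simp only [hi, if_false, gap, decisionValue]
    ring

/-- Summing `expect_value_succ` over the ages telescopes. The terminal value is `β f` times the
probability of delivery, since undelivered packets are worth 0 at the deadline. -/
theorem netReward_eq (g : N.PacketPolicy) :
    N.netReward μ f g =
      N.value μ f (N.source f) 0 - ∑ s ∈ Finset.range N.τ, N.expectedGap μ f g s := by
  have h0 : expect (N.packetLaw f g 0) (fun i => N.value μ f i 0)
      = N.value μ f (N.source f) 0 := by
    rw [packetLaw, expect_pure]
  have h1 : expect (N.packetLaw f g N.τ) (fun i => N.value μ f i N.τ)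
      = N.β f * (N.packetLaw f g N.τ (N.dest f)).toReal := by
    rw [expect, Finset.sum_eq_single (N.dest f)]
    · rw [value_dest, mul_comm]
    · intro i _ hi
      rw [value_deadline N μ f hi, mul_zero]
    · simp
  have h2 := Finset.sum_range_sub
    (fun s => expect (N.packetLaw f g s) (fun i => N.value μ f i s)) N.τ
  have h3 := Finset.sum_congr (rfl : Finset.range N.τ = Finset.range N.τ)
    fun s _ => N.expect_value_succ μ f g s
  rw [Finset.sum_add_distrib, Finset.sum_sub_distrib] at h3
  rw [Finset.sum_sub_distrib, h0, h1] at h2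
  rw [netReward]
  linarith

variable {N f} in
theorem expectedGap_nonneg (g : N.PacketPolicy) {s : ℕ} (hs : s < N.τ) :
    0 ≤ N.expectedGap μ f g s := by
  refine expect_nonneg fun i _ => ?_
  split_ifs with hi
  · exact le_rfl
  · exact gap_nonneg μ hi hs (N.act_mem_available g i s)

theorem netReward_le (g : N.PacketPolicy) :
    N.netReward μ f g ≤ N.value μ f (N.source f) 0 := by
  rw [netReward_eq]
  exact sub_le_self _
    (Finset.sum_nonneg fun s hs => expectedGap_nonneg μ g (Finset.mem_range.1 hs))

variable {N μ f} in
theorem SolvesDP.netReward_eq {g : N.PacketPolicy} (hg : N.SolvesDP μ f g) :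
    N.netReward μ f g = N.value μ f (N.source f) 0 := by
  rw [Network.netReward_eq, Finset.sum_eq_zero, sub_zero]
  intro s hs
  refine (expect_congr fun i _ => ?_).trans (expect_const (N.packetLaw f g s) 0)
  split_ifs with hi
  · rfl
  · have hs := Finset.mem_range.1 hs
    exact (gap_eq_zero_iff μ hi hs (N.act_mem_available g i s)).2 (hg i hi s hs)

variable {N μ f} in
theorem SolvesDP.solvesTransportation {g : N.PacketPolicy} (hg : N.SolvesDP μ f g) :
    N.SolvesTransportation μ f g := fun g' => by
  rw [hg.netReward_eq]
  exact N.netReward_le μ f g'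

/-- The upper bound `netReward_le` is attained by a policy that solves the dynamic programming
equations, so the maximal net reward is the value at the source. -/
theorem solvesTransportation_iff (g : N.PacketPolicy) :
    N.SolvesTransportation μ f g ↔ N.netReward μ f g = N.value μ f (N.source f) 0 := by
  constructor
  · intro h
    obtain ⟨g', hg'⟩ := N.exists_solvesDP μ f
    exact le_antisymm (N.netReward_le μ f g) (hg'.netReward_eq ▸ h g')
  · intro h g'
    rw [h]
    exact N.netReward_le μ f g'

end

section

variable (μ : E → ℝ)

/-! ### One time slot -/

/-- The law of the indicator that a packet is transmitted successfully under a decision. -/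
def successLaw : Option E → PMF Bool
  | none => PMF.pure false
  | some ℓ => coin (N.p ℓ) (N.p_le_one ℓ)

/-- The fate of one packet reads a single coordinate of a single channel, so only `channel_marginal`
matters. This is why the dependence between packets on a link can be arbitrary. -/
theorem map_success (u : N.Action) (σ : N.Slot) :
    (independent N.channel).map (fun w => N.success u w σ) = N.successLaw (u σ) := by
  cases hu : u σ with
  | none =>
    have h : (fun w : E → N.Slot → Bool => N.success u w σ) = Function.const _ false := by
      funext w
      simp [success, hu]
    rw [h, PMF.map_const]
    rfl
  | some ℓ =>
    have h : (fun w : E → N.Slot → Bool => N.success u w σ) =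
        (fun v : N.Slot → Bool => v σ) ∘ fun w => w ℓ := by
      funext w
      simp [success, hu]
    rw [h, ← PMF.map_comp, independent_map_apply]
    exact N.channel_marginal ℓ σ

/-- The location after a time slot of a packet of flow `f` that was located at `o`, for which the
decision `u` was taken, and that was transmitted successfully or not. -/
def advancePacket (f : F) : Option V → Option E → Bool → Option V
  | none, _, _ => none
  | some i, none, _ => some i
  | some i, some ℓ, b => if b then (if N.dst ℓ = N.dest f then none else some (N.dst ℓ)) else some i

theorem advance_eq (z : N.Record) (σ : N.Slot) :
    N.advance z σ = N.advancePacket σ.1 (z.1 σ) (z.2.1 σ) (z.2.2 σ) := by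
  rw [advance]
  cases z.1 σ <;> cases z.2.1 σ <;> rfl

open scoped Classical in
/-- The reward for the delivery of a packet, net of the price of its transmission. -/
def packetReward (f : F) (u : Option E) (b : Bool) : ℝ :=
  (if ∃ ℓ, u = some ℓ ∧ N.dst ℓ = N.dest f ∧ b = true then N.β f else 0) - price μ u

/-- The value of having a packet of age `s` at a location, nothing if there is no packet. -/
def occupantValue (f : F) (s : ℕ) (o : Option V) : ℝ :=
  o.elim 0 fun i => N.value μ f i s

/-- The loss from a decision for a packet at a location, nothing if there is no packet. -/
def occupantGap (f : F) (s : ℕ) (o : Option V) (u : Option E) : ℝ :=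
  o.elim 0 fun i => N.gap μ f i s u

/-- A delivered packet is removed, but its reward `β f` is the value that it would have at the
destination. Reward plus remaining value thus averages to the value of the decision. Without a
packet, `hu` excludes a transmission and all terms vanish. -/
theorem expect_packetReward_add {f : F} (s : ℕ) {o : Option V} {u : Option E}
    (ho : o ≠ some (N.dest f)) (hu : ∀ ℓ, u = some ℓ → o = some (N.src ℓ)) :
    expect (N.successLaw u) (fun b => N.packetReward μ f u b +
        N.occupantValue μ f (s + 1) (N.advancePacket f o u b)) =
      N.occupantValue μ f s o - N.occupantGap μ f s o u := by
  cases u with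
  | none =>
    cases o <;>
    simp [successLaw, expect_pure, packetReward, price, advancePacket, occupantValue, occupantGap,
      gap, decisionValue, move]
  | some ℓ =>
    rw [hu ℓ rfl]
    by_cases hd : N.dst ℓ = N.dest f
    · simp [successLaw, expect_coin, packetReward, price, advancePacket, occupantValue,
        occupantGap, gap, decisionValue, move, expect_map, hd, value_dest]
      ring
    · simp [successLaw, expect_coin, packetReward, price, advancePacket, occupantValue,
        occupantGap, gap, decisionValue, move, expect_map, hd]
      ring

/-- No packet is present at its own destination. -/
def Undelivered (x : N.State) : Prop :=
  ∀ σ, x σ ≠ some (N.dest σ.1)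

variable {N} in
theorem Undelivered.advance {z : N.Record} (hz : N.Undelivered z.1) (σ : N.Slot) :
    N.advance z σ ≠ some (N.dest σ.1) := by
  rw [advance_eq]
  have h := hz σ
  cases ho : z.1 σ with
  | none => simp [advancePacket]
  | some i =>
    rw [ho] at h
    cases z.2.1 σ with
    | none => simpa [advancePacket] using h
    | some ℓ =>
      simp only [advancePacket]
      split_ifs with h1 h2
      · simp
      · simpa using h2
      · exact h

variable {N} in
theorem Undelivered.next {z : N.Record} (hz : N.Undelivered z.1) (a : F → Fin (N.B + 1)) :
    N.Undelivered (N.next z a) := by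
  intro σ
  rw [Network.next]
  split_ifs with h1 h2
  · simpa using N.source_ne_dest σ.1
  · simp
  · exact hz.advance (σ.1, ⟨σ.2.1.val - 1, by omega⟩, σ.2.2)

theorem undelivered_firstState (a : F → Fin (N.B + 1)) : N.Undelivered (N.firstState a) := by
  intro σ
  rw [firstState]
  split_ifs with h
  · simpa using N.source_ne_dest σ.1
  · simp

variable {N} in
theorem of_mem_support_recordLaw {π : N.Policy} {h : List N.Record} {x : N.State} {z : N.Record}
    (hz : z ∈ (N.recordLaw π h x).support) : z.1 = x ∧ N.Feasible z.1 z.2.1 := by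
  simp only [recordLaw, PMF.mem_support_bind_iff, PMF.mem_support_map_iff] at hz
  obtain ⟨u, hu, w, _, rfl⟩ := hz
  exact ⟨rfl, π.feasible h x u hu⟩

theorem undelivered_of_mem_support_historyLaw (π : N.Policy) (t : ℕ) :
    ∀ hx ∈ (N.historyLaw π t).support, N.Undelivered hx.2 := by
  induction t with
  | zero =>
    intro hx h
    simp only [historyLaw, PMF.mem_support_map_iff] at h
    obtain ⟨a, _, rfl⟩ := h
    exact N.undelivered_firstState a
  | succ t ih =>
    intro hx h
    simp only [historyLaw, PMF.mem_support_bind_iff, PMF.mem_support_map_iff] at h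
    obtain ⟨hx', h', z, hz, a, _, rfl⟩ := h
    have hz' := (of_mem_support_recordLaw hz).1
    exact Undelivered.next (hz' ▸ ih hx' h') a

variable {N} in
theorem of_mem_support_slotLaw {π : N.Policy} {t : ℕ} {z : N.Record}
    (hz : z ∈ (N.slotLaw π t).support) : N.Undelivered z.1 ∧ N.Feasible z.1 z.2.1 := by
  simp only [slotLaw, PMF.mem_support_bind_iff] at hz
  obtain ⟨hx, h, hz⟩ := hz
  have hz' := of_mem_support_recordLaw hz
  exact ⟨hz'.1 ▸ N.undelivered_of_mem_support_historyLaw π t hx h, hz'.2⟩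

/-- The law of the state at the start of the time slot with index `t`. -/
def stateLaw (π : N.Policy) (t : ℕ) : PMF N.State :=
  (N.historyLaw π t).map Prod.snd

theorem stateLaw_zero (π : N.Policy) : N.stateLaw π 0 = N.arrival.map N.firstState := by
  rw [stateLaw, historyLaw, PMF.map_comp]
  rfl

theorem stateLaw_succ (π : N.Policy) (t : ℕ) :
    N.stateLaw π (t + 1) = (N.slotLaw π t).bind fun z => N.arrival.map (N.next z) := by
  simp only [stateLaw, historyLaw, slotLaw, PMF.map_bind, PMF.bind_bind, PMF.map_comp]
  rfl

/-- Conditioning on history and action removes the policy: only the average over the channels, for a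
fixed state and action, remains to be compared. -/
theorem expect_slotLaw_congr {π : N.Policy} {t : ℕ} {φ ψ : N.Record → ℝ}
    (hφ : ∀ x, N.Undelivered x → ∀ u, N.Feasible x u →
      expect (independent N.channel) (fun w => φ (x, u, N.success u w)) =
        expect (independent N.channel) (fun w => ψ (x, u, N.success u w))) :
    expect (N.slotLaw π t) φ = expect (N.slotLaw π t) ψ := by
  refine expect_bind_congr fun hx hhx => expect_bind_congr fun u hu => ?_
  rw [expect_map, expect_map]
  exact hφ hx.2 (N.undelivered_of_mem_support_historyLaw π t hx hhx) u (π.feasible _ _ u hu)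

theorem map_fst_slotLaw (π : N.Policy) (t : ℕ) :
    (N.slotLaw π t).map Prod.fst = N.stateLaw π t := by
  have h : ∀ hx : List N.Record × N.State,
      (N.recordLaw π hx.1 hx.2).map Prod.fst = PMF.pure hx.2 := fun hx => by
    simp only [recordLaw, PMF.map_bind, PMF.map_comp]
    rw [← PMF.bind_const (π.act hx.1 hx.2) (PMF.pure hx.2)]
    congr 1
    funext u
    exact PMF.map_const _ _
  rw [slotLaw, PMF.map_bind, stateLaw, ← PMF.bind_pure_comp]
  simp only [h]
  rfl

/-! ### The drift of the total value of the packets in the network -/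

/-- The weighted deliveries of a time slot, net of the prices of all transmissions. -/
def slotReward (z : N.Record) : ℝ :=
  ∑ f, N.β f * N.deliveries f z - ∑ ℓ, μ ℓ * N.linkUse ℓ z

/-- Double counting: each packet belongs to one flow and is transmitted on at most one link. -/
theorem slotReward_eq (z : N.Record) :
    N.slotReward μ z = ∑ σ : N.Slot, N.packetReward μ σ.1 (z.2.1 σ) (z.2.2 σ) := by
  classical
  simp only [slotReward, packetReward, Finset.sum_sub_distrib]
  congr 1
  · simp only [deliveries, Finset.card_filter, Nat.cast_sum, Finset.mul_sum]
    rw [Finset.sum_comm]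
    refine Finset.sum_congr rfl fun σ _ => ?_
    rw [Finset.sum_eq_single σ.1]
    · simp [Delivered]
    · intro f _ hf
      simp [hf.symm]
    · simp
  · simp only [linkUse, Finset.card_filter, Nat.cast_sum, Finset.mul_sum]
    rw [Finset.sum_comm]
    refine Finset.sum_congr rfl fun σ _ => ?_
    cases z.2.1 σ <;> simp [price]

/-- The total value of the packets in the network. -/
def totalValue (x : N.State) : ℝ :=
  ∑ σ : N.Slot, N.occupantValue μ σ.1 σ.2.1 (x σ)

/-- The total loss from the decisions of a time slot. -/
def totalGap (z : N.Record) : ℝ :=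
  ∑ σ : N.Slot, N.occupantGap μ σ.1 σ.2.1 (z.1 σ) (z.2.1 σ)

/-- The total value of the packets after the decisions of a time slot have taken effect. -/
def remainingValue (z : N.Record) : ℝ :=
  ∑ σ : N.Slot, N.occupantValue μ σ.1 (σ.2.1 + 1) (N.advance z σ)

/-- The expected number of packets of flow `f` that arrive in a time slot. -/
def arrivalRate (f : F) : ℝ :=
  ∑ k : Fin N.B, expect N.arrival fun a => if k.val < (a f).val then 1 else 0

/-- The expected total value of the packets that arrive in a time slot. -/
def arrivalValue : ℝ :=
  ∑ f, N.arrivalRate f * N.value μ f (N.source f) 0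

theorem expect_slotReward_add_remainingValue (π : N.Policy) (t : ℕ) :
    expect (N.slotLaw π t) (fun z => N.slotReward μ z + N.remainingValue μ z) =
      expect (N.slotLaw π t) (fun z => N.totalValue μ z.1 - N.totalGap μ z) := by
  refine N.expect_slotLaw_congr fun x hx u hu => ?_
  simp only [slotReward_eq, remainingValue, totalValue, totalGap, ← Finset.sum_add_distrib,
    ← Finset.sum_sub_distrib, advance_eq]
  rw [expect_sum, expect_sum]
  refine Finset.sum_congr rfl fun σ _ => ?_
  rw [expect_const, ← N.expect_packetReward_add μ _ (hx σ) (hu σ), ← map_success, expect_map]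

/-- Survivors move up one age, the slots of age 0 are refilled by arrivals, and the packets dropped
at the deadline have value 0. -/
theorem expect_totalValue_next {z : N.Record} (hz : N.Undelivered z.1) :
    expect N.arrival (fun a => N.totalValue μ (N.next z a)) =
      N.arrivalValue μ + N.remainingValue μ z := by
  have hlast : ∀ f (k : Fin N.B) (h : N.τ - 1 < N.τ),
      N.occupantValue μ f (N.τ - 1 + 1) (N.advance z (f, ⟨N.τ - 1, h⟩, k)) = 0 := by
    intro f k h
    have h1 := hz.advance (f, ⟨N.τ - 1, h⟩, k)
    rw [Nat.sub_add_cancel N.one_le_τ]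
    cases ho : N.advance z (f, ⟨N.τ - 1, h⟩, k) with
    | none => rfl
    | some i => exact N.value_deadline μ f fun hi => h1 (by rw [ho, hi])
  simp only [totalValue, remainingValue, arrivalValue, arrivalRate, expect_sum,
    Fintype.sum_prod_type, ← Finset.sum_add_distrib]
  refine Finset.sum_congr rfl fun f _ => ?_
  obtain ⟨n, hn⟩ : ∃ n, N.τ = n + 1 := ⟨N.τ - 1, by have := N.one_le_τ; omega⟩
  -- After this reindexing the sum for the next state sheds its first age (the arrivals) and the sum
  -- of remaining values its last age (the expiring packets). The other ages match with a shift by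
  -- one.
  have e1 : ∀ G : Fin N.τ → ℝ, ∑ s, G s = ∑ s : Fin (n + 1), G (Fin.cast hn.symm s) := fun G =>
    (Equiv.sum_comp (finCongr hn.symm) G).symm
  rw [e1, e1, Fin.sum_univ_succ, Fin.sum_univ_castSucc]
  have e2 : ∑ k : Fin N.B, N.occupantValue μ f ((Fin.cast hn.symm (Fin.last n)).val + 1)
      (N.advance z (f, Fin.cast hn.symm (Fin.last n), k)) = 0 := by
    refine Finset.sum_eq_zero fun k _ => ?_
    convert hlast f k (by omega) using 3 <;> simp [hn, Fin.ext_iff]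
  rw [e2, add_zero, Finset.sum_mul]
  congr 1
  · refine Finset.sum_congr rfl fun k _ => ?_
    rw [mul_comm, ← expect_const_mul]
    refine expect_congr fun a _ => ?_
    simp only [next, occupantValue]
    split_ifs <;> simp_all
  · refine Finset.sum_congr rfl fun s _ => Finset.sum_congr rfl fun k _ => ?_
    refine (expect_congr fun a _ => ?_).trans (expect_const N.arrival _)
    simp [next]
    rfl

/-- The drift identity, valid for every policy and every slot. Apart from the telescoping
difference, the policy enters only through the expected gap. -/
theorem expect_slotReward (π : N.Policy) (t : ℕ) :
    expect (N.slotLaw π t) (N.slotReward μ) =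
      N.arrivalValue μ + (expect (N.stateLaw π t) (N.totalValue μ) -
        expect (N.stateLaw π (t + 1)) (N.totalValue μ)) -
        expect (N.slotLaw π t) (N.totalGap μ) := by
  have h1 := N.expect_slotReward_add_remainingValue μ π t
  rw [expect_add, expect_sub, ← expect_map (N.slotLaw π t) Prod.fst, map_fst_slotLaw] at h1
  have h2 : expect (N.stateLaw π (t + 1)) (N.totalValue μ) =
      N.arrivalValue μ + expect (N.slotLaw π t) (N.remainingValue μ) := by
    rw [stateLaw_succ, expect_bind, ← expect_const (N.slotLaw π t) (N.arrivalValue μ),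
      ← expect_add]
    refine expect_congr fun z hz => ?_
    rw [expect_map]
    exact N.expect_totalValue_next μ (of_mem_support_slotLaw hz).1
  have h3 : expect (N.slotLaw π t) (N.slotReward μ) = expect (N.slotLaw π t)
    (fun z => N.slotReward μ z) := rfl
  have h4 : expect (N.slotLaw π t) (N.remainingValue μ) = expect (N.slotLaw π t)
    (fun z => N.remainingValue μ z) := rfl
  have h5 : expect (N.slotLaw π t) (N.totalGap μ) = expect (N.slotLaw π t)
    (fun z => N.totalGap μ z) := rfl
  rw [h2, h3, h4, h5]
  linarith

end

section

variable (Cav μ : E → ℝ)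

/-! ### The Lagrangian and the average loss -/

/-- The largest value of the Lagrangian. -/
def optimum : ℝ :=
  N.arrivalValue μ + ∑ ℓ, μ ℓ * Cav ℓ

variable {N} in
theorem Convergent.tendsto_averageDeliveries {π : N.Policy} (hπ : N.Convergent π) (f : F) :
    Tendsto (N.averageDeliveries π f) atTop (𝓝 (N.timelyThroughput π f)) :=
  tendsto_nhds_limUnder (hπ.1 f)

variable {N} in
theorem Convergent.tendsto_averageLinkUse {π : N.Policy} (hπ : N.Convergent π) (ℓ : E) :
    Tendsto (N.averageLinkUse π ℓ) atTop (𝓝 (N.averageBandwidth π ℓ)) :=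
  tendsto_nhds_limUnder (hπ.2 ℓ)

theorem timeAverage_slotReward (π : N.Policy) (T : ℕ) :
    timeAverage (fun t => expect (N.slotLaw π t) (N.slotReward μ)) T =
      ∑ f, N.β f * N.averageDeliveries π f T - ∑ ℓ, μ ℓ * N.averageLinkUse π ℓ T := by
  have h : ∀ t, expect (N.slotLaw π t) (N.slotReward μ) =
      ∑ f, N.β f * expect (N.slotLaw π t) (N.deliveries f) -
        ∑ ℓ, μ ℓ * expect (N.slotLaw π t) (N.linkUse ℓ) := fun t => by
    simp only [← expect_const_mul, ← expect_sum, ← expect_sub]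
    rfl
  simp only [h, averageDeliveries, averageLinkUse, timeAverage_sub, timeAverage_sum,
    timeAverage_const_mul]

theorem tendsto_timeAverage_drift (π : N.Policy) :
    Tendsto (timeAverage fun t => expect (N.stateLaw π t) (N.totalValue μ) -
      expect (N.stateLaw π (t + 1)) (N.totalValue μ)) atTop (𝓝 0) := by
  obtain ⟨C, hC⟩ := exists_forall_abs_le (N.totalValue μ)
  refine tendsto_timeAverage_telescope (C := C)
    (a := fun t => expect (N.stateLaw π t) (N.totalValue μ)) fun t => abs_le.2 ⟨?_, ?_⟩
  · rw [← expect_const (N.stateLaw π t) (-C)]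
    exact expect_mono fun x _ => (abs_le.1 (hC x)).1
  · rw [← expect_const (N.stateLaw π t) C]
    exact expect_mono fun x _ => (abs_le.1 (hC x)).2

-- The average of the drift identity: the potential is bounded, so its telescoping differences
-- contribute nothing in the limit. This turns maximizing the Lagrangian into minimizing the average
-- gap.
variable {N} in
theorem Convergent.tendsto_timeAverage_totalGap {π : N.Policy} (hπ : N.Convergent π) :
    Tendsto (timeAverage fun t => expect (N.slotLaw π t) (N.totalGap μ)) atTop
      (𝓝 (N.optimum Cav μ - N.lagrangian Cav π μ)) := by
  have h1 : Tendsto (timeAverage fun t => expect (N.slotLaw π t) (N.slotReward μ)) atTop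
      (𝓝 (∑ f, N.β f * N.timelyThroughput π f - ∑ ℓ, μ ℓ * N.averageBandwidth π ℓ)) := by
    refine Tendsto.congr (fun T => (N.timeAverage_slotReward μ π T).symm) (Tendsto.sub ?_ ?_)
    · exact tendsto_finsetSum _ fun f _ => (hπ.tendsto_averageDeliveries f).const_mul _
    · exact tendsto_finsetSum _ fun ℓ _ => (hπ.tendsto_averageLinkUse ℓ).const_mul _
  have h2 : Tendsto (timeAverage fun _ => N.arrivalValue μ) atTop (𝓝 (N.arrivalValue μ)) :=
    tendsto_timeAverage tendsto_const_nhds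
  have h3 := (h2.add (N.tendsto_timeAverage_drift μ π)).sub h1
  have h4 : N.arrivalValue μ + 0 -
      (∑ f, N.β f * N.timelyThroughput π f - ∑ ℓ, μ ℓ * N.averageBandwidth π ℓ) =
      N.optimum Cav μ - N.lagrangian Cav π μ := by
    simp only [optimum, lagrangian, mul_sub, Finset.sum_sub_distrib]
    ring
  rw [h4] at h3
  refine h3.congr fun T => ?_
  rw [← timeAverage_add, ← timeAverage_sub]
  congr 1
  funext t
  rw [N.expect_slotReward μ π t]
  ring

/-- There are finitely many combinations of flow, age, location and decision. Take `c` below all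
positive gaps and `C` above all gaps in absolute value. On the support, packets are undelivered and
decisions available, so the gap is positive exactly at suboptimal decisions. -/
theorem exists_totalGap_bounds : ∃ c > 0, ∃ C, ∀ (π : N.Policy) (t : ℕ),
    ∀ z ∈ (N.slotLaw π t).support, c * N.suboptimalDecisions μ z ≤ N.totalGap μ z ∧
      N.totalGap μ z ≤ C * N.suboptimalDecisions μ z := by
  classical
  let G : F × Fin N.τ × V × Option E → ℝ := fun x => N.gap μ x.1 x.2.2.1 x.2.1 x.2.2.2
  obtain ⟨c, hc, hcG⟩ := exists_pos_le_of_pos G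
  obtain ⟨C, hCG⟩ := exists_forall_abs_le G
  have key : ∀ (π : N.Policy) (t : ℕ), ∀ z ∈ (N.slotLaw π t).support, ∀ σ : N.Slot,
      c * (if ∃ i, z.1 σ = some i ∧ ¬ N.OptimalDecision μ σ.1 i σ.2.1 (z.2.1 σ) then 1 else 0) ≤
        N.occupantGap μ σ.1 σ.2.1 (z.1 σ) (z.2.1 σ) ∧
      N.occupantGap μ σ.1 σ.2.1 (z.1 σ) (z.2.1 σ) ≤
        C * (if ∃ i, z.1 σ = some i ∧ ¬ N.OptimalDecision μ σ.1 i σ.2.1 (z.2.1 σ)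
          then 1 else 0) := by
    intro π t z hz σ
    obtain ⟨hx, hu⟩ := of_mem_support_slotLaw hz
    cases hi : z.1 σ with
    | none => simp [occupantGap]
    | some i =>
      have hid : i ≠ N.dest σ.1 := fun h => hx σ (by rw [hi, h])
      have hav : z.2.1 σ ∈ N.available i := N.mem_available.2 fun ℓ hℓ => by
        have := hu σ ℓ hℓ
        rw [hi] at this
        exact (Option.some.inj this).symm
      have h0 := gap_eq_zero_iff μ hid σ.2.1.isLt hav
      by_cases ho : N.OptimalDecision μ σ.1 i σ.2.1 (z.2.1 σ)
      · simp [occupantGap, h0.2 ho, ho]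
      · have hpos : 0 < N.gap μ σ.1 i σ.2.1 (z.2.1 σ) :=
          lt_of_le_of_ne (gap_nonneg μ hid σ.2.1.isLt hav) fun h => ho (h0.1 h.symm)
        simp only [Option.some.injEq, exists_eq_left', ho, not_false_eq_true, if_true, mul_one,
          occupantGap, Option.elim]
        exact ⟨hcG (σ.1, σ.2.1, i, z.2.1 σ) hpos,
          (le_abs_self _).trans (hCG (σ.1, σ.2.1, i, z.2.1 σ))⟩
  refine ⟨c, hc, C, fun π t z hz => ?_⟩
  simp only [suboptimalDecisions, totalGap, Finset.card_filter, Nat.cast_sum, Finset.mul_sum,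
    Nat.cast_ite, Nat.cast_one, Nat.cast_zero]
  exact ⟨Finset.sum_le_sum fun σ _ => (key π t z hz σ).1,
    Finset.sum_le_sum fun σ _ => (key π t z hz σ).2⟩

theorem suboptimalDecisions_nonneg (z : N.Record) : 0 ≤ N.suboptimalDecisions μ z :=
  Nat.cast_nonneg _

theorem timeAverage_nonneg_of_expect {π : N.Policy} {φ : N.Record → ℝ}
    (h : ∀ t, ∀ z ∈ (N.slotLaw π t).support, 0 ≤ φ z) (T : ℕ) :
    0 ≤ timeAverage (fun t => expect (N.slotLaw π t) φ) T :=
  div_nonneg (Finset.sum_nonneg fun t _ => expect_nonneg (h t)) (Nat.cast_nonneg T)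

theorem totalGap_nonneg {π : N.Policy} {t : ℕ} {z : N.Record}
    (hz : z ∈ (N.slotLaw π t).support) : 0 ≤ N.totalGap μ z := by
  obtain ⟨c, hc, C, h⟩ := N.exists_totalGap_bounds μ
  exact (mul_nonneg hc.le (N.suboptimalDecisions_nonneg μ z)).trans (h π t z hz).1

theorem treatsPacketsOptimally_iff (π : N.Policy) : N.TreatsPacketsOptimally μ π ↔
    Tendsto (timeAverage fun t => expect (N.slotLaw π t) (N.totalGap μ)) atTop (𝓝 0) := by
  obtain ⟨c, hc, C, h⟩ := N.exists_totalGap_bounds μ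
  have h1 : ∀ T, c * timeAverage (fun t => expect (N.slotLaw π t) (N.suboptimalDecisions μ)) T ≤
      timeAverage (fun t => expect (N.slotLaw π t) (N.totalGap μ)) T := fun T => by
    rw [← timeAverage_const_mul]
    refine timeAverage_mono (fun t => ?_) T
    rw [← expect_const_mul]
    exact expect_mono fun z hz => (h π t z hz).1
  have h2 : ∀ T, timeAverage (fun t => expect (N.slotLaw π t) (N.totalGap μ)) T ≤
      C * timeAverage (fun t => expect (N.slotLaw π t) (N.suboptimalDecisions μ)) T := fun T => by
    rw [← timeAverage_const_mul]
    refine timeAverage_mono (fun t => ?_) T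
    rw [← expect_const_mul]
    exact expect_mono fun z hz => (h π t z hz).2
  constructor
  · intro h0
    have h3 := Tendsto.const_mul C h0
    rw [mul_zero] at h3
    exact squeeze_zero
      (N.timeAverage_nonneg_of_expect fun t z hz => N.totalGap_nonneg μ hz) h2 h3
  · intro h0
    have h3 := h0.const_mul c⁻¹
    rw [mul_zero] at h3
    refine squeeze_zero
      (N.timeAverage_nonneg_of_expect fun t z _ => N.suboptimalDecisions_nonneg μ z)
      (fun T => ?_) h3
    rw [← div_eq_inv_mul, le_div_iff₀' hc]
    exact h1 T

variable {N} in
theorem Convergent.lagrangian_le {π : N.Policy} (hπ : N.Convergent π) :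
    N.lagrangian Cav π μ ≤ N.optimum Cav μ :=
  sub_nonneg.1 (ge_of_tendsto' (hπ.tendsto_timeAverage_totalGap Cav μ)
    (N.timeAverage_nonneg_of_expect fun _ _ hz => N.totalGap_nonneg μ hz))

variable {N} in
theorem Convergent.lagrangian_eq_iff {π : N.Policy} (hπ : N.Convergent π) :
    N.lagrangian Cav π μ = N.optimum Cav μ ↔ N.TreatsPacketsOptimally μ π := by
  have h := hπ.tendsto_timeAverage_totalGap Cav μ
  rw [treatsPacketsOptimally_iff]
  constructor
  · intro h0
    rwa [h0, sub_self] at h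
  · intro h0
    exact (sub_eq_zero.1 (tendsto_nhds_unique h h0)).symm

/-! ### Product policies -/

variable (g : F → N.PacketPolicy)

/-- The decision of a packet policy for a packet at a location, if there is one. -/
def occupantAction (g : N.PacketPolicy) (s : ℕ) (o : Option V) : Option E :=
  o.bind fun i => g.act i s

/-- The law under a product policy of the location of the packet with number `k` of flow `f` at
age `s`, `none` if it did not arrive or has been delivered. -/
def occupantLaw (f : F) (k s : ℕ) : PMF (Option V) :=
  N.arrival.bind fun a =>
    if k < (a f).val then
      (N.packetLaw f (g f) s).map fun i => if i = N.dest f then none else some i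
    else PMF.pure none

/-- The transition law under a packet policy of the location of a packet. -/
def occupantStep (f : F) (s : ℕ) (o : Option V) : PMF (Option V) :=
  (N.successLaw (occupantAction N (g f) s o)).map
    (N.advancePacket f o (occupantAction N (g f) s o))

theorem occupantStep_none (f : F) (s : ℕ) : N.occupantStep g f s none = PMF.pure none := by
  rw [occupantStep]
  exact PMF.map_const _ _

theorem occupantStep_some {f : F} (s : ℕ) {i : V} (hi : i ≠ N.dest f) :
    N.occupantStep g f s (some i) =
      (N.move i ((g f).act i s)).map fun j => if j = N.dest f then none else some j := by
  simp only [occupantStep, occupantAction, Option.bind_some]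
  cases (g f).act i s with
  | none => simp [successLaw, move, PMF.pure_map, advancePacket, hi]
  | some ℓ =>
    simp only [successLaw, move, PMF.map_comp]
    congr 1
    funext b
    cases b <;> simp [advancePacket, hi]

/-- Absorption at the destination and removal on delivery are the same motion once the destination
is identified with `none`. This identification commutes with one step. -/
theorem occupantLaw_succ (f : F) (k s : ℕ) :
    N.occupantLaw g f k (s + 1) = (N.occupantLaw g f k s).bind (N.occupantStep g f s) := by
  rw [occupantLaw, occupantLaw, PMF.bind_bind]
  congr 1
  funext a
  split_ifs with h
  · rw [packetLaw, PMF.map_bind, PMF.bind_map]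
    congr 1
    funext i
    by_cases hi : i = N.dest f
    · simp [hi, PMF.pure_map, occupantStep_none]
    · simp [hi, occupantStep_some]
  · rw [PMF.pure_bind, occupantStep_none]

theorem slotLaw_product (t : ℕ) : N.slotLaw (N.product g) t =
    (N.stateLaw (N.product g) t).bind fun x =>
      (independent N.channel).map fun w =>
        (x, fun σ => occupantAction N (g σ.1) σ.2.1 (x σ),
          N.success (fun σ => occupantAction N (g σ.1) σ.2.1 (x σ)) w) := by
  rw [slotLaw, stateLaw, PMF.bind_map]
  congr 1
  funext hx
  rw [recordLaw, product, PMF.pure_bind]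
  rfl

/-- Under a product policy each packet moves as a Markov chain of its own, driven by its own success
indicator. A packet of age `s` in slot `t` arrived in slot `t - s`, and all arrival vectors have the
same law, so `t` drops out as soon as `t ≥ s`. -/
theorem map_stateLaw_product (f : F) (k : Fin N.B) (s : ℕ) (hs : s < N.τ) :
    ∀ t ≥ s, (N.stateLaw (N.product g) t).map (fun x => x (f, ⟨s, hs⟩, k)) =
      N.occupantLaw g f k s := by
  induction s with
  | zero =>
    have h0 : ∀ a : F → Fin (N.B + 1), (if k.val < (a f).val then some (N.source f) else none) =
        N.firstState a (f, ⟨0, hs⟩, k) := fun a => by simp [firstState]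
    have h1 : N.arrival.map (fun a => if k.val < (a f).val then some (N.source f) else none) =
        N.occupantLaw g f k 0 := by
      rw [occupantLaw, ← PMF.bind_pure_comp]
      congr 1
      funext a
      simp only [packetLaw, PMF.pure_map, N.source_ne_dest f, if_false, Function.comp_apply]
      split_ifs <;> rfl
    -- New packets come from `firstState` in slot 0 and from `next` afterwards, with the same law.
    rintro (_ | t) _
    · rw [stateLaw_zero, PMF.map_comp, ← h1]
      congr 1
      funext a
      exact (h0 a).symm
    · rw [stateLaw_succ, PMF.map_bind, ← h1]
      refine Eq.trans ?_ (PMF.bind_const (N.slotLaw (N.product g) t) _)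
      congr 1
      funext z
      rw [PMF.map_comp]
      rfl
  | succ s ih =>
    rintro (_ | t) ht
    · omega
    · have hs' : s < N.τ := by omega
      rw [stateLaw_succ, PMF.map_bind, slotLaw_product, PMF.bind_bind, occupantLaw_succ,
        ← ih hs' t (by omega), PMF.bind_map]
      congr 1
      funext x
      rw [PMF.bind_map]
      -- A slot of positive age is filled from the preceding record alone; the new arrivals do not
      -- affect it.
      have h : ∀ z : N.Record,
          (N.arrival.map (N.next z)).map (fun x => x (f, ⟨s + 1, hs⟩, k)) =
            PMF.pure (N.advance z (f, ⟨s, hs'⟩, k)) := fun z => by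
        rw [PMF.map_comp]
        exact PMF.map_const _ _
      simp only [Function.comp_def, h, occupantStep]
      rw [← map_success N (fun σ => occupantAction N (g σ.1) σ.2.1 (x σ)) (f, ⟨s, hs'⟩, k),
        PMF.map_comp, ← PMF.bind_pure_comp]
      simp only [advance_eq]
      rfl

/-- For a quantity that is additive over packets the one-packet marginals suffice. From slot `τ` on
every age has its stationary marginal, so the right side is free of `t`; this is what makes product
policies convergent. -/
theorem expect_slotLaw_product (ψ : N.Slot → Option V → Option E → Bool → ℝ) {t : ℕ}
    (ht : N.τ ≤ t) :
    expect (N.slotLaw (N.product g) t) (fun z => ∑ σ, ψ σ (z.1 σ) (z.2.1 σ) (z.2.2 σ)) =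
      ∑ σ : N.Slot, expect (N.occupantLaw g σ.1 σ.2.2 σ.2.1) fun o =>
        expect (N.successLaw (occupantAction N (g σ.1) σ.2.1 o))
          (ψ σ o (occupantAction N (g σ.1) σ.2.1 o)) := by
  rw [expect_sum]
  refine Finset.sum_congr rfl fun σ _ => ?_
  obtain ⟨f, s, k⟩ := σ
  rw [slotLaw_product, expect_bind, ← N.map_stateLaw_product g f k s.val s.isLt t (by omega),
    expect_map]
  refine expect_congr fun x _ => ?_
  rw [expect_map, ← map_success N (fun σ => occupantAction N (g σ.1) σ.2.1 (x σ)) (f, s, k),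
    expect_map]

theorem convergent_product : N.Convergent (N.product g) := by
  classical
  constructor
  · intro f
    have h : N.deliveries f = fun z => ∑ σ : N.Slot,
        if σ.1 = f ∧ ∃ ℓ, z.2.1 σ = some ℓ ∧ N.dst ℓ = N.dest σ.1 ∧ z.2.2 σ = true
          then 1 else 0 := by
      funext z
      rw [Finset.sum_boole]
      exact congrArg (fun s : Finset N.Slot => (s.card : ℝ))
        (Finset.ext fun _ => by rw [Finset.mem_filter, Finset.mem_filter]; rfl)
    exact ⟨_, tendsto_timeAverage_of_eventually_eq fun t ht => h ▸ N.expect_slotLaw_product g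
      (fun σ _ u b =>
        if σ.1 = f ∧ ∃ ℓ, u = some ℓ ∧ N.dst ℓ = N.dest σ.1 ∧ b = true then 1 else 0) ht⟩
  · intro ℓ
    have h : N.linkUse ℓ = fun z => ∑ σ : N.Slot, if z.2.1 σ = some ℓ then 1 else 0 := by
      funext z
      simp [linkUse]
    exact ⟨_, tendsto_timeAverage_of_eventually_eq fun t ht => h ▸ N.expect_slotLaw_product g
      (fun _ _ u _ => if u = some ℓ then 1 else 0) ht⟩

theorem expect_occupantLaw (f : F) (k s : ℕ) {φ : Option V → ℝ} (h0 : φ none = 0) :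
    expect (N.occupantLaw g f k s) φ =
      expect N.arrival (fun a => if k < (a f).val then 1 else 0) *
        expect (N.packetLaw f (g f) s) fun i => if i = N.dest f then 0 else φ (some i) := by
  rw [occupantLaw, expect_bind, mul_comm, ← expect_const_mul]
  refine expect_congr fun a _ => ?_
  split_ifs with h
  · rw [expect_map, mul_one]
    refine expect_congr fun i _ => ?_
    split_ifs <;> simp [h0]
  · rw [expect_pure, h0, mul_zero]

/-- In a stationary slot, summing over the ages present amounts to following one packet through its
life. By `netReward_eq` its gaps add up to the shortfall of its net reward, and the packet numbers
contribute the arrival rate. -/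
theorem expect_totalGap_product {t : ℕ} (ht : N.τ ≤ t) :
    expect (N.slotLaw (N.product g) t) (N.totalGap μ) =
      ∑ f, N.arrivalRate f * (N.value μ f (N.source f) 0 - N.netReward μ f (g f)) := by
  refine (N.expect_slotLaw_product g (fun σ o u _ => N.occupantGap μ σ.1 σ.2.1 o u) ht).trans ?_
  simp only [expect_const, Fintype.sum_prod_type, arrivalRate, netReward_eq, sub_sub_cancel]
  refine Finset.sum_congr rfl fun f _ => ?_
  rw [← Fin.sum_univ_eq_sum_range, Finset.mul_sum]
  refine Finset.sum_congr rfl fun s _ => ?_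
  rw [Finset.sum_mul]
  refine Finset.sum_congr rfl fun k _ => ?_
  rw [N.expect_occupantLaw g f k s rfl]
  rfl

theorem lagrangian_product : N.lagrangian Cav (N.product g) μ = N.optimum Cav μ -
    ∑ f, N.arrivalRate f * (N.value μ f (N.source f) 0 - N.netReward μ f (g f)) := by
  have h1 := (N.convergent_product g).tendsto_timeAverage_totalGap Cav μ
  have h2 := tendsto_timeAverage_of_eventually_eq
    (a := fun t => expect (N.slotLaw (N.product g) t) (N.totalGap μ))
    fun t (ht : t ≥ N.τ) => N.expect_totalGap_product μ g ht
  linarith [tendsto_nhds_unique h1 h2]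

theorem arrivalRate_nonneg (f : F) : 0 ≤ N.arrivalRate f :=
  Finset.sum_nonneg fun k _ => expect_nonneg fun a _ => by split_ifs <;> norm_num

theorem arrivalRate_ne_zero_iff (f : F) : N.arrivalRate f ≠ 0 ↔ N.HasTraffic f := by
  have hnn : ∀ k : Fin N.B, ∀ a ∈ N.arrival.support,
      (0 : ℝ) ≤ if k.val < (a f).val then 1 else 0 := fun k a _ => by split_ifs <;> norm_num
  constructor
  · intro h
    by_contra hf
    refine h (Finset.sum_eq_zero fun k _ =>
      (expect_congr fun a ha => if_neg fun hk => ?_).trans (expect_const N.arrival 0))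
    exact hf ⟨a, ha, by omega⟩
  · rintro ⟨a, ha, hpos⟩
    have hB : 0 < N.B := by omega
    -- Number 0 is occupied whenever any packet of the flow arrives.
    refine ne_of_gt (Finset.sum_pos' (fun k _ => expect_nonneg (hnn k))
      ⟨⟨0, hB⟩, Finset.mem_univ _, expect_pos (hnn ⟨0, hB⟩) ha ?_⟩)
    simp [hpos]

/-- The deficit is a sum of nonnegative terms, rate times shortfall, so it vanishes iff every flow
has zero rate or zero shortfall. -/
theorem lagrangian_product_eq_iff : N.lagrangian Cav (N.product g) μ = N.optimum Cav μ ↔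
    ∀ f, N.HasTraffic f → N.SolvesTransportation μ f (g f) := by
  rw [lagrangian_product, sub_eq_self, Finset.sum_eq_zero_iff_of_nonneg fun f _ =>
    mul_nonneg (N.arrivalRate_nonneg f) (sub_nonneg.2 (N.netReward_le μ f (g f)))]
  refine forall_congr' fun f => ?_
  rw [← arrivalRate_ne_zero_iff, solvesTransportation_iff]
  simp only [Finset.mem_univ, true_imp_iff, mul_eq_zero, sub_eq_zero, or_iff_not_imp_left,
    eq_comm (a := N.value μ f (N.source f) 0), ne_eq]

/-! ### Attainment of the optimum and the dual function -/

theorem exists_lagrangian_eq_optimum :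
    ∃ π : N.Policy, N.Convergent π ∧ N.lagrangian Cav π μ = N.optimum Cav μ := by
  choose g hg using fun f => N.exists_solvesDP μ f
  exact ⟨N.product g, N.convergent_product g,
    (N.lagrangian_product_eq_iff Cav μ g).2 fun f _ => (hg f).solvesTransportation⟩

/-- The supremum is an attained maximum, so `sSup` does not take its default value here. -/
theorem dual_eq_optimum : N.dual Cav μ = N.optimum Cav μ := by
  refine IsGreatest.csSup_eq ⟨?_, ?_⟩
  · obtain ⟨π, hπ, h⟩ := N.exists_lagrangian_eq_optimum Cav μ
    exact ⟨π, hπ, h.symm⟩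
  · rintro L ⟨π, hπ, rfl⟩
    exact hπ.lagrangian_le Cav μ

variable {N} in
theorem Convergent.maximizesLagrangian_iff {π : N.Policy} (hπ : N.Convergent π) :
    N.MaximizesLagrangian Cav μ π ↔ N.lagrangian Cav π μ = N.optimum Cav μ := by
  constructor
  · intro h
    obtain ⟨π', hπ', h'⟩ := N.exists_lagrangian_eq_optimum Cav μ
    exact le_antisymm (hπ.lagrangian_le Cav μ) (h'.symm.trans_le (h.2 π' hπ'))
  · intro h
    exact ⟨hπ, fun π' hπ' => (hπ'.lagrangian_le Cav μ).trans_eq h.symm⟩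

end

end Network

end TimelyThroughput

end

theorem mainTheorem6 {V E F : Type*} [Fintype V] [DecidableEq V] [Fintype E] [DecidableEq E]
    [Fintype F] [DecidableEq F] (N : TimelyThroughput.Network V E F)
    (Cav μ : E → ℝ) (hμ : ∀ ℓ, 0 ≤ μ ℓ) :
    -- the dynamic programming equations yield solutions of the single packet problem
    (∀ f, (∃ g, N.SolvesDP μ f g) ∧ ∀ g, N.SolvesDP μ f g → N.SolvesTransportation μ f g) ∧
    -- the product of single packet solutions maximizes the Lagrangian
    (∀ g : F → N.PacketPolicy, (∀ f, N.SolvesTransportation μ f (g f)) →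
      N.MaximizesLagrangian Cav μ (N.product g) ∧
        N.lagrangian Cav (N.product g) μ = N.dual Cav μ) ∧
    -- among product policies there are no other maximizers
    (∀ g : F → N.PacketPolicy, N.MaximizesLagrangian Cav μ (N.product g) ↔
      ∀ f, N.HasTraffic f → N.SolvesTransportation μ f (g f)) ∧
    -- an arbitrary policy maximizes the Lagrangian iff it attains the dual function, and iff it
    -- treats the packets as in the single packet problem
    (∀ π : N.Policy, N.Convergent π →
      (N.MaximizesLagrangian Cav μ π ↔ N.lagrangian Cav π μ = N.dual Cav μ) ∧
        (N.MaximizesLagrangian Cav μ π ↔ N.TreatsPacketsOptimally μ π)) := by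
  refine ⟨fun f => ⟨N.exists_solvesDP μ f, fun g hg => hg.solvesTransportation⟩,
    fun g hg => ?_, fun g => ?_, fun π hπ => ⟨?_, ?_⟩⟩
  · have h := (N.lagrangian_product_eq_iff Cav μ g).2 fun f _ => hg f
    exact ⟨((N.convergent_product g).maximizesLagrangian_iff Cav μ).2 h,
      h.trans (N.dual_eq_optimum Cav μ).symm⟩
  · rw [(N.convergent_product g).maximizesLagrangian_iff, N.lagrangian_product_eq_iff]
  · rw [hπ.maximizesLagrangian_iff, N.dual_eq_optimum]
  · rw [hπ.maximizesLagrangian_iff, hπ.lagrangian_eq_iff]
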